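/- For $n\ge 1$ let $X_n=\{1,\dots,n\}\times\mathbb{N}$, and let permutations of $X_n$ act from the right. Let $\mathrm{FSym}(X_n)$ be the group of permutations of $X_n$ that move only finitely many points. Let $H_n\le \mathrm{Sym}(X_n)$ be the Houghton group, i.e. the group of all permutations $g$ of $X_n$ for which there are $z_1,\dots,z_n\in\mathbb{N}$ and $t_1,\dots,t_n\in\mathbb{Z}$ with $(i,m)g=(i,m+t_i)$ for all $i$ and all $m\ge z_i$. Let $S_n$ act on $X_n$ by $(i,m)\sigma=(i\sigma,m)$, and regard $H_n\rtimes S_n$ as the subgroup of $\mathrm{Sym}(X_n)$ generated by $H_n$ and $S_n$. Fix $n$ and a finite family $s_1,\dots,s_k$ of elements of $H_n\rtimes S_n$ (for instance, when $n\ge 2$, a finite generating set of this group). There is an algorithm which, given two words over $s_1^{\pm1},\dots,s_k^{\pm1}$ representing elements $a,b\in H_n\rtimes S_n$, decides whether there exists $x\in\mathrm{FSym}(X_n)$ with $x^{-1}ax=b$ and, if such an $x$ exists, outputs one (as a finite product of transpositions of points of $X_n$). -/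

import Mathlib

namespace Houghton

open Equiv

/-- The set `X_n`: `n` copies (rays) of the natural numbers. A point `(i, m)` is the point at
position `m` of the `i`-th ray, positions being counted from `0`. -/
abbrev X (n : ℕ) : Type := Fin n × ℕ

/-- The finitary symmetric group: the permutations which move only finitely many points. -/
def FSym (α : Type*) : Subgroup (Perm α) where
  carrier := {g | {p | g p ≠ p}.Finite}
  one_mem' := by simp
  mul_mem' := by
    intro a b ha hb
    refine (Set.Finite.union ha hb).subset ?_
    intro p hp
    by_contra hc
    simp only [Set.mem_union, Set.mem_ofPred_eq, not_or, not_not] at hc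
    exact hp (by rw [Perm.mul_apply, hc.2, hc.1])
  inv_mem' := by
    intro a ha
    refine Set.Finite.subset ha ?_
    intro p hp hc
    exact hp (by rw [Perm.inv_eq_iff_eq, hc])

/-- `g` maps `(i, m)` to `(i, m + t i)` for all `m ≥ z i`, on every ray `i`. -/
def EventuallyTranslates {n : ℕ} (g : Perm (X n)) (z : Fin n → ℕ) (t : Fin n → ℤ) : Prop :=
  ∀ i m, z i ≤ m → (g (i, m)).1 = i ∧ ((g (i, m)).2 : ℤ) = m + t i

/-- The Houghton group `H_n`: the permutations of `X_n` that are eventually a translation on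
each ray. -/
def H (n : ℕ) : Subgroup (Perm (X n)) where
  carrier := {g | ∃ z t, EventuallyTranslates g z t}
  one_mem' := ⟨0, 0, fun i m _ => by simp⟩
  mul_mem' := by
    rintro a b ⟨z, t, h⟩ ⟨z', t', h'⟩
    refine ⟨fun i => z' i + z i + (t' i).natAbs, fun i => t i + t' i, fun i m hm => ?_⟩
    dsimp only at hm
    obtain ⟨h1, h2⟩ := h' i m (by omega)
    have hb : b (i, m) = (i, (b (i, m)).2) := Prod.ext h1 rfl
    obtain ⟨h3, h4⟩ := h i (b (i, m)).2 (by omega)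
    rw [← hb] at h3 h4
    exact ⟨h3, by rw [Perm.mul_apply, h4, h2]; ring⟩
  inv_mem' := by
    rintro a ⟨z, t, h⟩
    refine ⟨fun i => z i + (t i).natAbs, fun i => - t i, fun i m hm => ?_⟩
    dsimp only at hm
    obtain ⟨k, hk⟩ : ∃ k : ℕ, (k : ℤ) = m - t i := ⟨(m - t i).toNat, by omega⟩
    obtain ⟨h1, h2⟩ := h i k (by omega)
    have ha : a (i, k) = (i, m) := Prod.ext h1 (by omega)
    have hi : a⁻¹ (i, m) = (i, k) := by rw [Perm.inv_eq_iff_eq, ha]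
    rw [hi]
    exact ⟨rfl, by rw [hk]; ring⟩

/-- The action of `S_n` on `X_n` by isometric permutations of the rays, `(i, m) ↦ (σ i, m)`. -/
def rayPerm (n : ℕ) : Perm (Fin n) →* Perm (X n) where
  toFun σ := σ.prodCongr (Equiv.refl ℕ)
  map_one' := by ext p <;> simp
  map_mul' σ τ := by ext p <;> simp

/-- The group `H_n ⋊ S_n`, as the subgroup of `Sym(X_n)` generated by `H_n` and the isometric
permutations of the rays. (The latter normalise `H_n` and meet it trivially, so that this is the
internal semidirect product.) -/
def HS (n : ℕ) : Subgroup (Perm (X n)) := H n ⊔ (rayPerm n).range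

/-- Words over the alphabet of `k` generators and their formal inverses: `(j, true)` stands for
the `j`-th generator and `(j, false)` for its inverse. -/
abbrev Word (k : ℕ) : Type := List (Fin k × Bool)

/-- The permutation that a letter represents. -/
def letterPerm {α : Type*} {k : ℕ} (s : Fin k → Perm α) (c : Fin k × Bool) : Perm α :=
  if c.2 then s c.1 else (s c.1)⁻¹

/-- The permutation that a word represents. Permutations act from the right in words: the first
letter is applied first. -/
def wordPerm {α : Type*} {k : ℕ} (s : Fin k → Perm α) : Word k → Perm α
  | [] => 1
  | c :: w => wordPerm s w * letterPerm s c

/-- `x` conjugates `a` to `b`. For permutations acting from the right this is `x⁻¹ a x = b`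
(first `x⁻¹`, then `a`, then `x`); as functions composed from right to left it reads as below. -/
def Conjugates {α : Type*} (x a b : Perm α) : Prop := x * a * x⁻¹ = b

/-- The finitary permutation described by a finite list of pairs of points: the product of the
corresponding transpositions. -/
def swapsPerm {α : Type*} [DecidableEq α] (l : List (α × α)) : Perm α :=
  (l.map fun p => swap p.1 p.2).prod

end Houghton

/-! An element of `HS n` acts far out by `(i, m) ↦ (σ i, m + t i)`, with a threshold and shift bound
linear in word length. The point is to bound the support of some conjugator; a finite search then
decides the problem.

If a finitary `x` conjugates `a` to `b`, then `a` and `b` have the same `σ` and `t`, so they agree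
on a far region `R`. Let `G` be the set of points whose whole `a`-orbit stays in `R`. Replacing `x`
by its first-return map outside `G`, extended by the identity on `G`, still gives a conjugator
(`exists_conjugator_fixing`).

A sufficiently far point drifts outwards or not at all, under `a` or under `a⁻¹`, so one of its
half-orbits stays in `R`. If this half-orbit is finite, the point lies in `G`. Otherwise `x` fixes
some point of it, and pulling back shows that `x` fixes the given point
(`zpow_mem_or_fixed_of_forward`). So the new conjugator fixes every sufficiently far point
(`exists_conjugator_supported`). Conjugation by such a permutation can be checked on finitely many
points (`conjugates_of_conjugatesBelow`). -/

namespace Houghton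

open Equiv

/-! ### First-return permutations and modification of a conjugator. -/

section FirstReturn

variable {α : Type*}

/-- `q` is the first point outside `G` on the forward `x`-orbit of the point `p` outside `G`. -/
def FirstReturn (x : Perm α) (G : Set α) (p q : α) : Prop :=
  p ∉ G ∧ q ∉ G ∧ ∃ j : ℕ, (x ^ (j + 1)) p = q ∧ ∀ i < j, (x ^ (i + 1)) p ∈ G

theorem FirstReturn.unique {x : Perm α} {G : Set α} {p q q' : α} (h : FirstReturn x G p q)
    (h' : FirstReturn x G p q') : q = q' := by
  obtain ⟨-, hq, j, rfl, hj⟩ := h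
  obtain ⟨-, hq', j', rfl, hj'⟩ := h'
  rcases lt_trichotomy j j' with hlt | rfl | hlt
  · exact absurd (hj' j hlt) hq
  · rfl
  · exact absurd (hj j' hlt) hq'

theorem FirstReturn.symm {x : Perm α} {G : Set α} {p q : α} (h : FirstReturn x G p q) :
    FirstReturn x⁻¹ G q p := by
  obtain ⟨hp, hq, j, rfl, hj⟩ := h
  refine ⟨hq, hp, j, by simp, fun i hi => ?_⟩
  have h1 := hj (j - i - 1) (by omega)
  have h2 : x ^ (j + 1) = x ^ (i + 1) * x ^ (j - i - 1 + 1) := by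
    rw [← pow_add]; congr 1; omega
  rw [h2, Perm.mul_apply, inv_pow, Perm.inv_def, symm_apply_apply]
  exact h1

theorem exists_firstReturn {x : Perm α} (hx : ∀ p, ∃ j : ℕ, (x ^ (j + 1)) p = p) (G : Set α)
    {p : α} (hp : p ∉ G) : ∃ q, FirstReturn x G p q := by
  classical
  have h : ∃ j : ℕ, (x ^ (j + 1)) p ∉ G := by
    obtain ⟨j, hj⟩ := hx p
    exact ⟨j, by rwa [hj]⟩
  exact ⟨_, hp, Nat.find_spec h, Nat.find h, rfl, fun i hi => not_not.1 (Nat.find_min h hi)⟩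

/-- The permutation induced on the complement of `G` by a permutation with finite orbits,
extended by the identity on `G`. -/
theorem exists_induced_perm {x : Perm α} (hx : ∀ p, ∃ j : ℕ, (x ^ (j + 1)) p = p) (G : Set α) :
    ∃ y : Perm α, (∀ p ∈ G, y p = p) ∧ ∀ p ∉ G, FirstReturn x G p (y p) := by
  have hx' : ∀ p, ∃ j : ℕ, (x⁻¹ ^ (j + 1)) p = p := fun p => by
    obtain ⟨j, hj⟩ := hx p
    exact ⟨j, by rw [inv_pow, Perm.inv_eq_iff_eq, hj]⟩
  have key : ∀ z : Perm α, (∀ p, ∃ j : ℕ, (z ^ (j + 1)) p = p) →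
      ∃ r : α → α, (∀ p ∈ G, r p = p) ∧ ∀ p ∉ G, FirstReturn z G p (r p) := by
    intro z hz
    have : ∀ p, ∃ q, (p ∈ G → q = p) ∧ (p ∉ G → FirstReturn z G p q) := by
      intro p
      by_cases hp : p ∈ G
      · exact ⟨p, fun _ => rfl, fun h => absurd hp h⟩
      · obtain ⟨q, hq⟩ := exists_firstReturn hz G hp
        exact ⟨q, fun h => absurd h hp, fun _ => hq⟩
    choose r hr using this
    exact ⟨r, fun p => (hr p).1, fun p => (hr p).2⟩
  -- The first-return maps of `x` and `x⁻¹` are mutually inverse, by reversing orbit segments.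
  obtain ⟨r, hr, hr'⟩ := key x hx
  obtain ⟨s, hs, hs'⟩ := key x⁻¹ hx'
  refine ⟨⟨r, s, fun p => ?_, fun p => ?_⟩, hr, hr'⟩
  · by_cases hp : p ∈ G
    · rw [hr p hp, hs p hp]
    · exact (hs' _ (hr' p hp).2.1).unique (hr' p hp).symm
  · by_cases hp : p ∈ G
    · rw [hs p hp, hr p hp]
    · have := (hs' p hp).symm
      rw [inv_inv] at this
      exact (hr' _ (hs' p hp).2.1).unique this

/-- The orbit of a moved point stays inside the finite support, so the pigeonhole principle applies.
-/
theorem exists_pow_apply_eq_self_of_mem_FSym {x : Perm α} (hx : x ∈ FSym α) (p : α) :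
    ∃ j : ℕ, (x ^ (j + 1)) p = p := by
  by_cases hp : x p = p
  · exact ⟨0, by simpa using hp⟩
  have hfin : {q | x q ≠ q}.Finite := hx
  have hmem : ∀ j : ℕ, (x ^ j) p ∈ {q | x q ≠ q} := fun j h => hp <| by
    have : (x ^ j) (x p) = (x ^ j) p := by
      rw [← Perm.mul_apply, (Commute.pow_self x j).eq, Perm.mul_apply]
      exact h
    exact (x ^ j).injective this
  have hninj : ¬ Function.Injective fun j : ℕ => (x ^ j) p := fun hinj =>
    Set.infinite_of_injective_forall_mem hinj hmem hfin
  obtain ⟨i, j, hij, hne⟩ : ∃ i j : ℕ, (x ^ i) p = (x ^ j) p ∧ i < j := by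
    simp only [Function.Injective, not_forall] at hninj
    obtain ⟨i, j, h, hne⟩ := hninj
    rcases Nat.lt_or_gt_of_ne hne with h' | h'
    exacts [⟨i, j, h, h'⟩, ⟨j, i, h.symm, h'⟩]
  refine ⟨j - i - 1, (x ^ i).injective ?_⟩
  rw [← Perm.mul_apply, ← pow_add, hij]
  congr 2; omega

/-- While the `x`-orbit of `p` runs through `G`, where `a = b`, each step trades `b` back for `a`,
so the `x`-orbit of `a p` runs parallel to it and leaves `G` at the same time. -/
theorem FirstReturn.map {x a b : Perm α} (hx : ∀ q, x (a q) = b (x q)) {G : Set α}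
    (hab : ∀ p ∈ G, a p = b p) (hGa : ∀ p, a p ∈ G ↔ p ∈ G) (hGb : ∀ p, b p ∈ G ↔ p ∈ G) {p q : α}
    (h : FirstReturn x G p q) : FirstReturn x G (a p) (b q) := by
  obtain ⟨hp, hq, j, rfl, hj⟩ := h
  have key : ∀ i ≤ j, (x ^ (i + 1)) (a p) = b ((x ^ (i + 1)) p) := by
    intro i
    induction i with
    | zero => intro _; simpa using hx p
    | succ i ih =>
      intro hi
      rw [pow_succ', Perm.mul_apply, ih (by omega), ← hab _ (hj i (by omega)), hx,
        Perm.mul_apply]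
  refine ⟨by rwa [hGa], by rwa [hGb], j, key j le_rfl, fun i hi => ?_⟩
  rw [key i hi.le, hGb]
  exact hj i hi

/-- If `x` conjugates `a` to `b` and `a` agrees with `b` on an `a`-invariant set `G`, then the
permutation induced by `x` outside `G` conjugates `a` to `b` as well. -/
theorem exists_conjugator_fixing {x a b : Perm α} (hx : x ∈ FSym α) (hxab : ∀ q, x (a q) = b (x q))
    {G : Set α} (hab : ∀ p ∈ G, a p = b p) (hGa : ∀ p, a p ∈ G ↔ p ∈ G) :
    ∃ y : Perm α, (∀ q, y (a q) = b (y q)) ∧ (∀ p ∈ G, y p = p) ∧ ∀ p, x p = p → y p = p := by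
  -- If `b p ∈ G`, then `a⁻¹ (b p)` lies in `G`, where `a = b`; injectivity of `b` identifies it
  -- with `p`.
  have hGb : ∀ p, b p ∈ G ↔ p ∈ G := by
    intro p
    constructor
    · intro h
      have h1 : a⁻¹ (b p) ∈ G := by rw [← hGa]; simpa using h
      have h2 := hab _ h1
      rw [Perm.inv_def, apply_symm_apply] at h2
      rw [Perm.inv_def] at h1
      rwa [← b.injective h2] at h1
    · intro h
      rwa [← hab p h, hGa]
  obtain ⟨y, hy, hy'⟩ := exists_induced_perm (exists_pow_apply_eq_self_of_mem_FSym hx) G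
  refine ⟨y, fun q => ?_, hy, fun p hp => ?_⟩
  · by_cases hq : q ∈ G
    · rw [hy q hq, hy _ ((hGa q).2 hq), hab q hq]
    · exact (hy' _ (by rwa [hGa])).unique ((hy' q hq).map hxab hab hGa hGb)
  · by_cases hpG : p ∈ G
    · exact hy p hpG
    · obtain ⟨-, -, j, hj, -⟩ := hy' p hpG
      rw [← hj]
      exact Perm.pow_apply_eq_self_of_apply_eq_self hp _

/-- A finitary conjugator fixes a point with a forward orbit on which `a` and `b` agree, unless
this orbit is finite. -/
theorem zpow_mem_or_fixed_of_forward {x a b : Perm α} (hx : x ∈ FSym α)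
    (hxab : ∀ q, x (a q) = b (x q)) {R : Set α} (hab : ∀ p ∈ R, a p = b p) {p : α}
    (hp : ∀ k : ℕ, (a ^ k) p ∈ R) : (∀ k : ℤ, (a ^ k) p ∈ R) ∨ x p = p := by
  by_cases hinj : Function.Injective fun k : ℕ => (a ^ k) p
  · right
    have hpow : ∀ k : ℕ, (a ^ k) p = (b ^ k) p := by
      intro k
      induction k with
      | zero => rfl
      | succ k ih =>
        rw [pow_succ', Perm.mul_apply, hab _ (hp k), ih, pow_succ', Perm.mul_apply]
    have hxpow : ∀ k : ℕ, x ((a ^ k) p) = (b ^ k) (x p) := by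
      intro k
      induction k with
      | zero => rfl
      | succ k ih => rw [pow_succ', Perm.mul_apply, hxab, ih, pow_succ', Perm.mul_apply]
    -- An infinite half-orbit leaves the finite support of `x`; at such a `k`, `b ^ k` can be
    -- cancelled.
    obtain ⟨k, hk⟩ : ∃ k : ℕ, x ((a ^ k) p) = (a ^ k) p := by
      by_contra! hcon
      exact Set.infinite_of_injective_forall_mem hinj hcon hx
    rw [hxpow, hpow] at hk
    exact (b ^ k).injective hk
  · left
    obtain ⟨d, hd0, hd⟩ : ∃ d : ℕ, 0 < d ∧ (a ^ d) p = p := by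
      simp only [Function.Injective, not_forall] at hinj
      have aux : ∀ i j : ℕ, i < j → (a ^ i) p = (a ^ j) p → ∃ d : ℕ, 0 < d ∧ (a ^ d) p = p := by
        intro i j hlt h
        refine ⟨j - i, by omega, (a ^ i).injective ?_⟩
        rw [← Perm.mul_apply, ← pow_add, h]
        congr 2; omega
      obtain ⟨i, j, h, hne⟩ := hinj
      rcases Nat.lt_or_gt_of_ne hne with h' | h'
      exacts [aux i j h' h, aux j i h' h.symm]
    intro k
    -- By periodicity, negative powers reduce to forward ones.
    have hmod : (a ^ k) p = (a ^ (k % d).toNat) p := by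
      have h0 : 0 ≤ k % d := Int.emod_nonneg _ (by omega)
      conv_lhs => rw [← Int.emod_add_mul_ediv k d, zpow_add, Perm.mul_apply, zpow_mul, zpow_natCast,
        Perm.zpow_apply_eq_self_of_apply_eq_self hd]
      rw [← zpow_natCast, Int.toNat_of_nonneg h0]
    rw [hmod]
    exact hp _

end FirstReturn

/-! ### Finitary permutations as products of transpositions. -/

/-- A permutation supported in a finite set is a short product of transpositions of points of
this set. -/
theorem exists_swapsPerm_eq {α : Type*} [DecidableEq α] (s : Finset α) (x : Perm α)
    (hx : ∀ p ∉ s, x p = p) :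
    ∃ l : List (α × α), l.length ≤ s.card ∧ (∀ q ∈ l, q.1 ∈ s ∧ q.2 ∈ s) ∧ swapsPerm l = x := by
  induction s using Finset.induction_on generalizing x with
  | empty => exact ⟨[], by simp, by simp, by ext p; simp [swapsPerm, hx p]⟩
  | insert c s hc ih =>
    have hmem : x c ∈ insert c s := by
      by_contra h
      exact h (by rw [x.injective (hx _ h)]; simp)
    -- The extra transposition makes `c` a fixed point.
    obtain ⟨l, hl, hl', hlx⟩ := ih (swap c (x c) * x) (by
      intro p hp
      by_cases hpc : p = c
      · subst hpc; simp
      · have hxp : x p = p := hx p (by simp [hp, hpc])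
        rw [Perm.mul_apply, hxp, swap_apply_of_ne_of_ne hpc]
        intro h
        exact hpc (x.injective (hxp.trans h)))
    refine ⟨(c, x c) :: l, ?_, ?_, ?_⟩
    · simp [Finset.card_insert_of_notMem hc, hl]
    · intro q hq
      rcases List.mem_cons.1 hq with rfl | hq
      · exact ⟨by simp, hmem⟩
      · exact ⟨Finset.mem_insert_of_mem (hl' q hq).1, Finset.mem_insert_of_mem (hl' q hq).2⟩
    · have : swapsPerm ((c, x c) :: l) = swap c (x c) * swapsPerm l := by simp [swapsPerm]
      rw [this, hlx, ← mul_assoc, swap_mul_self, one_mul]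

theorem swapsPerm_apply_of_forall_notMem {α : Type*} [DecidableEq α] {l : List (α × α)} {p : α}
    (h : ∀ q ∈ l, p ≠ q.1 ∧ p ≠ q.2) : swapsPerm l p = p := by
  induction l with
  | nil => rfl
  | cons q l ih =>
    have : swapsPerm (q :: l) = swap q.1 q.2 * swapsPerm l := by simp [swapsPerm]
    rw [this, Perm.mul_apply, ih fun r hr => h r (List.mem_cons_of_mem _ hr)]
    exact swap_apply_of_ne_of_ne (h q (by simp)).1 (h q (by simp)).2

theorem swapsPerm_mem_FSym {α : Type*} [DecidableEq α] (l : List (α × α)) :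
    swapsPerm l ∈ FSym α := by
  refine (List.finite_toSet (l.map Prod.fst ++ l.map Prod.snd)).subset fun p hp => ?_
  by_contra hcon
  refine hp (swapsPerm_apply_of_forall_notMem fun q hq => ⟨?_, ?_⟩)
  · rintro rfl
    exact hcon (List.mem_append_left _ (List.mem_map_of_mem hq))
  · rintro rfl
    exact hcon (List.mem_append_right _ (List.mem_map_of_mem hq))

theorem conjugates_iff {α : Type*} {x a b : Perm α} :
    Conjugates x a b ↔ ∀ q, x (a q) = b (x q) := by
  rw [Conjugates, mul_inv_eq_iff_eq_mul, Equiv.ext_iff]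
  rfl

/-! ### Eventual translations with explicit bounds. -/

/-- `g` maps `(i, m)` to `(σ i, m + t i)` for all `m ≥ Z`, with all `t i` bounded by `T`. -/
structure RayTranslates {n : ℕ} (g : Perm (X n)) (σ : Perm (Fin n)) (t : Fin n → ℤ) (Z T : ℕ) :
    Prop where
  natAbs_le : ∀ i, (t i).natAbs ≤ T
  fst_apply : ∀ i m, Z ≤ m → (g (i, m)).1 = σ i
  snd_apply : ∀ i m, Z ≤ m → ((g (i, m)).2 : ℤ) = m + t i

namespace RayTranslates

variable {n : ℕ} {g h : Perm (X n)} {σ τ : Perm (Fin n)} {t u : Fin n → ℤ} {Z Y T U : ℕ}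

theorem mono (hg : RayTranslates g σ t Z T) (hZ : Z ≤ Y) (hT : T ≤ U) :
    RayTranslates g σ t Y U :=
  ⟨fun i => (hg.natAbs_le i).trans hT, fun i m hm => hg.fst_apply i m (hZ.trans hm),
    fun i m hm => hg.snd_apply i m (hZ.trans hm)⟩

theorem apply_eq (hg : RayTranslates g σ t Z T) {i : Fin n} {m l : ℕ} (hm : Z ≤ m)
    (hl : (l : ℤ) = m + t i) : g (i, m) = (σ i, l) :=
  Prod.ext (hg.fst_apply i m hm) (by have := hg.snd_apply i m hm; dsimp only; omega)

protected theorem one : RayTranslates (1 : Perm (X n)) 1 0 0 0 :=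
  ⟨by simp, by simp, by simp⟩

protected theorem mul (hg : RayTranslates g σ t Z T) (hh : RayTranslates h τ u Y U) :
    RayTranslates (g * h) (σ * τ) (fun i => u i + t (τ i)) (Z + Y + U) (T + U) := by
  have key : ∀ i m, Z + Y + U ≤ m → ∃ l : ℕ, (l : ℤ) = m + u i ∧ Z ≤ l ∧ h (i, m) = (τ i, l) := by
    intro i m hm
    have hu := hh.natAbs_le i
    obtain ⟨l, hl⟩ : ∃ l : ℕ, (l : ℤ) = m + u i := ⟨(m + u i).toNat, by omega⟩
    exact ⟨l, hl, by omega, hh.apply_eq (by omega) hl⟩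
  refine ⟨fun i => ?_, fun i m hm => ?_, fun i m hm => ?_⟩
  · have h1 := hg.natAbs_le (τ i)
    have h2 := hh.natAbs_le i
    omega
  · obtain ⟨l, -, hl, he⟩ := key i m hm
    rw [Perm.mul_apply, he, hg.fst_apply _ _ hl, Perm.mul_apply]
  · obtain ⟨l, hl', hl, he⟩ := key i m hm
    rw [Perm.mul_apply, he, hg.snd_apply _ _ hl, hl', add_assoc]

protected theorem inv (hg : RayTranslates g σ t Z T) :
    RayTranslates g⁻¹ σ⁻¹ (fun i => - t (σ⁻¹ i)) (Z + T) T := by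
  have key : ∀ i m, Z + T ≤ m → ∃ l : ℕ, (l : ℤ) = m - t (σ⁻¹ i) ∧ g⁻¹ (i, m) = (σ⁻¹ i, l) := by
    intro i m hm
    have ht := hg.natAbs_le (σ⁻¹ i)
    obtain ⟨l, hl⟩ : ∃ l : ℕ, (l : ℤ) = m - t (σ⁻¹ i) := ⟨(m - t (σ⁻¹ i)).toNat, by omega⟩
    refine ⟨l, hl, ?_⟩
    rw [Perm.inv_eq_iff_eq, hg.apply_eq (l := m) (by omega) (by omega)]
    simp
  refine ⟨fun i => ?_, fun i m hm => ?_, fun i m hm => ?_⟩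
  · simpa using hg.natAbs_le (σ⁻¹ i)
  · obtain ⟨l, -, he⟩ := key i m hm
    rw [he]
  · obtain ⟨l, hl, he⟩ := key i m hm
    rw [he, hl, sub_eq_add_neg]

/-- Two eventual translations that agree at some far point of a ray have the same data there. -/
theorem eq_of_apply_eq (hg : RayTranslates g σ t Z T) (hh : RayTranslates h τ u Y U) {i : Fin n}
    {m : ℕ} (hZ : Z ≤ m) (hY : Y ≤ m) (he : g (i, m) = h (i, m)) : σ i = τ i ∧ t i = u i := by
  have h1 := hg.fst_apply i m hZ
  have h2 := hg.snd_apply i m hZ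
  rw [he, hh.fst_apply i m hY] at h1
  rw [he, hh.snd_apply i m hY] at h2
  exact ⟨h1.symm, by omega⟩

theorem apply_eq_apply (hg : RayTranslates g σ t Z T) (hh : RayTranslates h τ u Y U) {i : Fin n}
    (hσ : σ i = τ i) (ht : t i = u i) {m : ℕ} (hZ : Z ≤ m) (hY : Y ≤ m) :
    g (i, m) = h (i, m) := by
  refine Prod.ext ?_ ?_
  · rw [hg.fst_apply i m hZ, hh.fst_apply i m hY, hσ]
  · have h1 := hg.snd_apply i m hZ
    have h2 := hh.snd_apply i m hY
    omega

/-- The forward orbit of a far point on a ray with nonnegative drift stays far. -/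
theorem le_snd_pow_apply (hg : RayTranslates g σ t Z T) {d : ℕ} (hd : 0 < d) (hσ : σ ^ d = 1)
    {i : Fin n} (hi : 0 ≤ ∑ j ∈ Finset.range d, t ((σ ^ j) i)) {m : ℕ} (hm : Z + d * T ≤ m)
    (k : ℕ) : Z ≤ ((g ^ k) (i, m)).2 := by
  have hsmall : ∀ k : ℕ, -((k * T : ℕ) : ℤ) ≤ ∑ j ∈ Finset.range k, t ((σ ^ j) i) := by
    intro k
    induction k with
    | zero => simp
    | succ k ih =>
      have h1 := hg.natAbs_le ((σ ^ k) i)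
      rw [Finset.sum_range_succ, add_mul, one_mul]
      omega
  -- Complete periods contribute nonnegatively, so only fewer than `d` remaining steps can lose
  -- height.
  have hsum : ∀ k : ℕ, -((d * T : ℕ) : ℤ) ≤ ∑ j ∈ Finset.range k, t ((σ ^ j) i) := by
    intro k
    induction k using Nat.strong_induction_on with
    | _ k ih =>
      rcases lt_or_ge k d with hk | hk
      · refine le_trans ?_ (hsmall k)
        have := Nat.mul_le_mul_right T hk.le
        omega
      · obtain ⟨l, rfl⟩ := Nat.exists_eq_add_of_le hk
        have h1 := ih l (by omega)
        rw [Finset.sum_range_add]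
        have h2 : ∀ j, (σ ^ (d + j)) i = (σ ^ j) i := fun j => by rw [pow_add, hσ, one_mul]
        simp only [h2]
        omega
  have key : ∀ k : ℕ, ((g ^ k) (i, m)).1 = (σ ^ k) i ∧
      (((g ^ k) (i, m)).2 : ℤ) = m + ∑ j ∈ Finset.range k, t ((σ ^ j) i) := by
    intro k
    induction k with
    | zero => simp
    | succ k ih =>
      obtain ⟨h1, h2⟩ := ih
      have h3 := hsum k
      have hZ : Z ≤ ((g ^ k) (i, m)).2 := by omega
      have he : (g ^ k) (i, m) = ((σ ^ k) i, ((g ^ k) (i, m)).2) := Prod.ext h1 rfl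
      have h4 := hg.fst_apply ((σ ^ k) i) _ hZ
      have h5 := hg.snd_apply ((σ ^ k) i) _ hZ
      rw [← he] at h4 h5
      rw [pow_succ', pow_succ', Perm.mul_apply, Perm.mul_apply, Finset.sum_range_succ]
      exact ⟨h4, by rw [h5, h2, add_assoc]⟩
  have h1 := (key k).2
  have h2 := hsum k
  omega

/-- Inverting reverses the drift over a period: a ray with nonpositive drift for `g` has nonnegative
drift for `g⁻¹`. -/
theorem sum_range_inv {d : ℕ} (hσ : σ ^ d = 1) (t : Fin n → ℤ) (i : Fin n) :
    ∑ j ∈ Finset.range d, - t (σ⁻¹ ((σ⁻¹ ^ j) i)) = - ∑ j ∈ Finset.range d, t ((σ ^ j) i) := by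
  rw [Finset.sum_neg_distrib, ← Finset.sum_range_reflect]
  congr 1
  refine Finset.sum_congr rfl fun j hj => ?_
  have hj' := Finset.mem_range.1 hj
  congr 1
  rw [← Perm.mul_apply, ← pow_succ', inv_pow, Perm.inv_eq_iff_eq, ← Perm.mul_apply, ← pow_add]
  rw [show d - 1 - j + 1 + j = d by omega, hσ]
  rfl

end RayTranslates

/-! ### Bounding the support of a conjugator. -/

/-- If two eventual translations are conjugate by a finitary permutation, then they are conjugate by
one whose support lies in an explicit region. -/
theorem exists_conjugator_supported {n : ℕ} {a b x : Perm (X n)} {σ τ : Perm (Fin n)}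
    {t u : Fin n → ℤ} {Z T : ℕ} (ha : RayTranslates a σ t Z T) (hb : RayTranslates b τ u Z T)
    (hx : x ∈ FSym (X n)) (hxab : Conjugates x a b) :
    ∃ y : Perm (X n), Conjugates y a b ∧
      ∀ i m, Z + T + Fintype.card (Perm (Fin n)) * T ≤ m → y (i, m) = (i, m) := by
  rw [conjugates_iff] at hxab
  -- Far out, `x` fixes both `p` and `a p`, so `a p = x (a p) = b (x p) = b p`; one such point on
  -- each ray determines the data.
  have hdata : ∀ i, σ i = τ i ∧ t i = u i := by
    intro i
    have hfin : ({q | x q ≠ q} ∪ a ⁻¹' {q | x q ≠ q}).Finite :=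
      Set.Finite.union hx (Set.Finite.preimage a.injective.injOn hx)
    have hinj : Function.Injective fun m : ℕ => ((i, Z + m) : X n) := fun m m' h => by
      simpa using h
    obtain ⟨m, hm⟩ : ∃ m : ℕ, ((i, Z + m) : X n) ∉ {q | x q ≠ q} ∪ a ⁻¹' {q | x q ≠ q} := by
      by_contra! hcon
      exact Set.infinite_of_injective_forall_mem hinj hcon hfin
    have h1 : x (i, Z + m) = (i, Z + m) := by
      by_contra h
      exact hm (Or.inl h)
    have h2 : x (a (i, Z + m)) = a (i, Z + m) := by
      by_contra h
      exact hm (Or.inr h)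
    refine ha.eq_of_apply_eq hb (Nat.le_add_right Z m) (Nat.le_add_right Z m) ?_
    rw [← h2, hxab, h1]
  obtain rfl : σ = τ := Equiv.ext fun i => (hdata i).1
  obtain rfl : t = u := funext fun i => (hdata i).2
  set d := Fintype.card (Perm (Fin n)) with hd
  have hd0 : 0 < d := Fintype.card_pos
  have hσ : σ ^ d = 1 := pow_card_eq_one
  -- The margin `T` makes `a⁻¹` and `b⁻¹` agree on `R` too, as the backward case needs.
  let R : Set (X n) := {p | Z + T ≤ p.2}
  have hab : ∀ p ∈ R, a p = b p := fun ⟨i, m⟩ hp =>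
    have hp' : Z + T ≤ m := hp
    ha.apply_eq_apply hb rfl rfl (by omega) (by omega)
  have hab' : ∀ p ∈ R, a⁻¹ p = b⁻¹ p := fun ⟨i, m⟩ hp =>
    ha.inv.apply_eq_apply hb.inv rfl rfl hp hp
  have hxab' : ∀ q, x (a⁻¹ q) = b⁻¹ (x q) := by
    intro q
    rw [eq_comm, Perm.inv_eq_iff_eq, ← hxab]
    simp
  let G : Set (X n) := {p | ∀ k : ℤ, (a ^ k) p ∈ R}
  have hGa : ∀ p, a p ∈ G ↔ p ∈ G := by
    intro p
    constructor
    · intro h k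
      have := h (k - 1)
      rwa [← Perm.mul_apply, ← zpow_add_one, sub_add_cancel] at this
    · intro h k
      have := h (k + 1)
      rwa [zpow_add_one, Perm.mul_apply] at this
  have hfar : ∀ i m, Z + T + d * T ≤ m → (i, m) ∈ G ∨ x (i, m) = (i, m) := by
    intro i m hm
    rcases le_total 0 (∑ j ∈ Finset.range d, t ((σ ^ j) i)) with h | h
    · exact zpow_mem_or_fixed_of_forward hx hxab hab
        ((ha.mono (Nat.le_add_right Z T) le_rfl).le_snd_pow_apply hd0 hσ h hm)
    · rw [← Left.nonneg_neg_iff, ← RayTranslates.sum_range_inv hσ] at h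
      refine (zpow_mem_or_fixed_of_forward hx hxab' hab'
        (ha.inv.le_snd_pow_apply hd0 (by rw [inv_pow, hσ, inv_one]) h hm)).imp_left
        fun hG k => ?_
      have := hG (-k)
      rwa [inv_zpow', neg_neg] at this
  obtain ⟨y, hy, hyG, hyx⟩ :=
    exists_conjugator_fixing hx hxab (G := G) (fun p hp => hab p (hp 0)) hGa
  exact ⟨y, conjugates_iff.2 hy, fun i m hm => (hfar i m hm).elim (hyG _) (hyx _)⟩

/-! ### Bounds for words. -/

theorem exists_rayTranslates_of_mem_HS {n : ℕ} {g : Perm (X n)} (hg : g ∈ HS n) :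
    ∃ σ t Z T, RayTranslates g σ t Z T := by
  let K : Subgroup (Perm (X n)) :=
    { carrier := {g | ∃ σ t Z T, RayTranslates g σ t Z T}
      one_mem' := ⟨_, _, _, _, .one⟩
      mul_mem' := by
        rintro _ _ ⟨_, _, _, _, h⟩ ⟨_, _, _, _, h'⟩
        exact ⟨_, _, _, _, h.mul h'⟩
      inv_mem' := by
        rintro _ ⟨_, _, _, _, h⟩
        exact ⟨_, _, _, _, h.inv⟩ }
  refine (sup_le (c := K) ?_ ?_ : HS n ≤ K) hg
  · rintro g ⟨z, t, h⟩
    refine ⟨1, t, Finset.univ.sup z, Finset.univ.sup fun i => (t i).natAbs,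
      fun i => Finset.le_sup (f := fun i => (t i).natAbs) (Finset.mem_univ i),
      fun i m hm => ?_, fun i m hm => ?_⟩
    · exact (h i m ((Finset.le_sup (Finset.mem_univ i)).trans hm)).1
    · exact (h i m ((Finset.le_sup (Finset.mem_univ i)).trans hm)).2
  · rintro _ ⟨σ, rfl⟩
    exact ⟨σ, 0, 0, 0, by simp, by simp [rayPerm], by simp [rayPerm]⟩

/-- The letters of a finite alphabet of elements of `HS n` are eventual translations with a common
bound. -/
theorem exists_letterPerm_rayTranslates {n k : ℕ} {s : Fin k → Perm (X n)}
    (hs : ∀ j, s j ∈ HS n) :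
    ∃ (C : ℕ) (σ : Fin k × Bool → Perm (Fin n)) (t : Fin k × Bool → Fin n → ℤ),
      ∀ c, RayTranslates (letterPerm s c) (σ c) (t c) C C := by
  have h : ∀ c, ∃ σ t Z T, RayTranslates (letterPerm s c) σ t Z T := by
    intro c
    refine exists_rayTranslates_of_mem_HS ?_
    unfold letterPerm
    split_ifs
    exacts [hs _, inv_mem (hs _)]
  choose σ t Z T h using h
  refine ⟨Finset.univ.sup Z + Finset.univ.sup T, σ, t, fun c => (h c).mono ?_ ?_⟩
  · exact (Finset.le_sup (Finset.mem_univ c)).trans (Nat.le_add_right _ _)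
  · exact (Finset.le_sup (Finset.mem_univ c)).trans (Nat.le_add_left _ _)

/-- Each letter raises the threshold by its own threshold `C` plus its shift bound `C`, hence the
factor `2 * C`. -/
theorem exists_wordPerm_rayTranslates {n k : ℕ} {s : Fin k → Perm (X n)} {C : ℕ}
    {σ : Fin k × Bool → Perm (Fin n)} {t : Fin k × Bool → Fin n → ℤ}
    (h : ∀ c, RayTranslates (letterPerm s c) (σ c) (t c) C C) (w : Word k) :
    ∃ τ u, RayTranslates (wordPerm s w) τ u (2 * C * w.length) (2 * C * w.length) := by
  induction w with
  | nil => exact ⟨_, _, .one⟩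
  | cons c w ih =>
    obtain ⟨τ, u, hw⟩ := ih
    refine ⟨_, _, (hw.mul (h c)).mono ?_ ?_⟩
    all_goals
      rw [List.length_cons, mul_add, mul_one]
      omega

/-! ### Primitive recursiveness of the actions and of the enumeration. -/

theorem primrec_letterPerm {n k : ℕ} {s : Fin k → Perm (X n)} {C : ℕ}
    {σ : Fin k × Bool → Perm (Fin n)} {t : Fin k × Bool → Fin n → ℤ}
    (h : ∀ c, RayTranslates (letterPerm s c) (σ c) (t c) C C) :
    Primrec₂ fun (c : Fin k × Bool) (p : X n) => letterPerm s c p := by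
  -- A letter is a finite table below `C` and a formula beyond, where lookup yields `none`. The
  -- natural subtraction in the formula does not truncate, since shifts are at most `C ≤ m`.
  let tab : (Fin k × Bool) × Fin n → List (X n) := fun q =>
    (List.range C).map fun m => letterPerm s q.1 (q.2, m)
  have hray : Primrec fun q : (Fin k × Bool) × X n => (q.1, q.2.1) :=
    Primrec.pair Primrec.fst (Primrec.fst.comp Primrec.snd)
  have hpos : Primrec fun q : (Fin k × Bool) × X n => q.2.2 := Primrec.snd.comp Primrec.snd
  have hnear : Primrec fun q : (Fin k × Bool) × X n => (tab (q.1, q.2.1))[q.2.2]? :=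
    Primrec.list_getElem?.comp ((Primrec.dom_finite tab).comp hray) hpos
  have hfar : Primrec fun q : (Fin k × Bool) × X n =>
      ((σ q.1 q.2.1, q.2.2 + (t q.1 q.2.1).toNat - (-t q.1 q.2.1).toNat) : X n) :=
    Primrec.pair
      ((Primrec.dom_finite fun r : (Fin k × Bool) × Fin n => σ r.1 r.2).comp hray)
      (Primrec.nat_sub.comp
        (Primrec.nat_add.comp hpos
          ((Primrec.dom_finite fun r : (Fin k × Bool) × Fin n => (t r.1 r.2).toNat).comp hray))
        ((Primrec.dom_finite fun r : (Fin k × Bool) × Fin n => (-t r.1 r.2).toNat).comp hray))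
  refine (Primrec.option_getD.comp hnear hfar).of_eq fun q => ?_
  obtain ⟨c, i, m⟩ := q
  rcases lt_or_ge m C with hm | hm
  · simp [tab, hm]
  · have h1 := (h c).natAbs_le i
    dsimp only
    rw [(h c).apply_eq (i := i) (l := m + (t c i).toNat - (-t c i).toNat) hm (by omega)]
    simp [tab, hm]

theorem primrec_wordPerm {n k : ℕ} {s : Fin k → Perm (X n)}
    (hs : Primrec₂ fun (c : Fin k × Bool) (p : X n) => letterPerm s c p) :
    Primrec₂ fun (w : Word k) (p : X n) => wordPerm s w p := by
  refine (Primrec.list_foldl (f := fun q : Word k × X n => q.1) (g := fun q => q.2)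
    (h := fun _ r => letterPerm s r.2 r.1) Primrec.fst Primrec.snd
    (hs.comp (Primrec.snd.comp Primrec.snd) (Primrec.fst.comp Primrec.snd)).to₂).of_eq ?_
  rintro ⟨w, p⟩
  induction w generalizing p with
  | nil => rfl
  | cons c w ih => exact ih (letterPerm s c p)

theorem primrec_swapsPerm {α : Type*} [Primcodable α] [DecidableEq α] :
    Primrec₂ fun (l : List (α × α)) (p : α) => swapsPerm l p := by
  have hswap : Primrec fun r : (α × α) × α => swap r.1.1 r.1.2 r.2 := by
    have h1 : Primrec fun r : (α × α) × α => r.1.1 := Primrec.fst.comp Primrec.fst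
    have h2 : Primrec fun r : (α × α) × α => r.1.2 := Primrec.snd.comp Primrec.fst
    exact (Primrec.ite (Primrec.eq.comp Primrec.snd h1) h2
      (Primrec.ite (Primrec.eq.comp Primrec.snd h2) h1 Primrec.snd)).of_eq
      fun r => (swap_apply_def _ _ _).symm
  refine (Primrec.list_foldr (f := fun q : List (α × α) × α => q.1) (g := fun q => q.2)
    (h := fun _ r => swap r.1.1 r.1.2 r.2) Primrec.fst Primrec.snd
    (hswap.comp Primrec.snd).to₂).of_eq ?_
  rintro ⟨l, p⟩
  induction l with
  | nil => rfl
  | cons q l ih =>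
    have : swapsPerm (q :: l) = swap q.1 q.2 * swapsPerm l := by simp [swapsPerm]
    simp only [List.foldr_cons] at ih ⊢
    rw [ih, this, Perm.mul_apply]

/-- The points of `X n` at positions below `N`. -/
def pointsBelow (n N : ℕ) : List (X n) :=
  (List.range N).flatMap fun m => (List.finRange n).map fun i => (i, m)

theorem mem_pointsBelow {n N : ℕ} {p : X n} : p ∈ pointsBelow n N ↔ p.2 < N := by
  obtain ⟨i, m⟩ := p
  simp [pointsBelow]

theorem primrec_pointsBelow (n : ℕ) : Primrec (pointsBelow n) :=
  Primrec.list_flatMap Primrec.list_range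
    (Primrec.list_map (Primrec.const (List.finRange n))
      (Primrec.pair Primrec.snd (Primrec.snd.comp Primrec.fst)).to₂).to₂

/-- All lists of length at most `L` with entries in `A`. -/
def listsUpTo {α : Type*} (A : List α) (L : ℕ) : List (List α) :=
  Nat.rec [[]] (fun _ IH => [] :: A.flatMap fun p => IH.map (p :: ·)) L

theorem mem_listsUpTo {α : Type*} {A : List α} {L : ℕ} {l : List α} :
    l ∈ listsUpTo A L ↔ l.length ≤ L ∧ ∀ p ∈ l, p ∈ A := by
  induction L generalizing l with
  | zero =>
    change l ∈ [[]] ↔ _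
    simp only [List.mem_singleton, Nat.le_zero, List.length_eq_zero_iff]
    constructor
    · rintro rfl
      simp
    · exact fun h => h.1
  | succ L ih =>
    change l ∈ [] :: A.flatMap (fun p => (listsUpTo A L).map (p :: ·)) ↔ _
    cases l with
    | nil => simp
    | cons q l =>
      simp only [List.mem_cons, reduceCtorEq, false_or, List.mem_flatMap, List.mem_map,
        List.cons.injEq, List.length_cons, forall_eq_or_imp, Nat.add_le_add_iff_right]
      constructor
      · rintro ⟨p, hp, l', hl', rfl, rfl⟩
        exact ⟨(ih.1 hl').1, hp, (ih.1 hl').2⟩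
      · rintro ⟨h1, h2, h3⟩
        exact ⟨q, h2, l, ih.2 ⟨h1, h3⟩, rfl, rfl⟩

theorem primrec_listsUpTo {α : Type*} [Primcodable α] :
    Primrec₂ (listsUpTo : List α → ℕ → List (List α)) := by
  refine (Primrec.nat_rec (f := fun _ : List α => [[]])
    (g := fun A r => [] :: A.flatMap fun p => r.2.map (p :: ·)) (Primrec.const _) ?_)
  refine Primrec.list_cons.comp (Primrec.const []) (Primrec.list_flatMap Primrec.fst ?_)
  exact Primrec.list_map (Primrec.snd.comp (Primrec.snd.comp Primrec.fst))
    (Primrec.list_cons.comp (Primrec.snd.comp Primrec.fst) Primrec.snd).to₂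

theorem primrec_list_product {α : Type*} [Primcodable α] :
    Primrec fun A : List α => A ×ˢ A :=
  Primrec.list_flatMap Primrec.id (Primrec.list_map Primrec.fst
    (Primrec.pair (Primrec.snd.comp Primrec.fst) Primrec.snd).to₂).to₂

/-! ### The bounded search and its correctness. -/

/-- `x` intertwines `a` and `b` on the points at positions below `N`, for `x` given by a list of
pairs and `a`, `b` given by words. -/
def ConjugatesBelow {n k : ℕ} (s : Fin k → Perm (X n)) (N : ℕ) (a b : Word k)
    (l : List (X n × X n)) : Prop :=
  ∀ p ∈ pointsBelow n N, swapsPerm l (wordPerm s a p) = wordPerm s b (swapsPerm l p)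

instance {n k : ℕ} (s : Fin k → Perm (X n)) (N : ℕ) (a b : Word k) (l : List (X n × X n)) :
    Decidable (ConjugatesBelow s N a b l) :=
  inferInstanceAs (Decidable (∀ p ∈ pointsBelow n N, _))

theorem primrecPred_conjugatesBelow {n k : ℕ} {s : Fin k → Perm (X n)}
    (hs : Primrec₂ fun (c : Fin k × Bool) (p : X n) => letterPerm s c p) :
    PrimrecRel fun (l : List (X n × X n)) (q : ℕ × Word k × Word k) =>
      ConjugatesBelow s q.1 q.2.1 q.2.2 l := by
  have hR : PrimrecRel fun (p : X n) (r : List (X n × X n) × ℕ × Word k × Word k) =>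
      swapsPerm r.1 (wordPerm s r.2.2.1 p) = wordPerm s r.2.2.2 (swapsPerm r.1 p) := by
    have hp := Primrec.fst (α := X n) (β := List (X n × X n) × ℕ × Word k × Word k)
    have hr := Primrec.snd (α := X n) (β := List (X n × X n) × ℕ × Word k × Word k)
    have hl := Primrec.fst.comp hr
    have hw := Primrec.snd.comp (Primrec.snd.comp hr)
    exact Primrec.eq.comp
      (primrec_swapsPerm.comp hl ((primrec_wordPerm hs).comp (Primrec.fst.comp hw) hp))
      ((primrec_wordPerm hs).comp (Primrec.snd.comp hw) (primrec_swapsPerm.comp hl hp))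
  exact hR.forall_mem_list.comp
    ((primrec_pointsBelow n).comp (Primrec.fst.comp Primrec.snd)) Primrec.id

/-- The first list of pairs of points at positions below `N` that describes a conjugator of `a`
into `b`, as far as this is visible below `N + B + 1`. -/
def findConjugator {n k : ℕ} (s : Fin k → Perm (X n)) (N B : ℕ) (a b : Word k) :
    Option (List (X n × X n)) :=
  ((listsUpTo (pointsBelow n N ×ˢ pointsBelow n N) (pointsBelow n N).length).filter
    fun l => ConjugatesBelow s (N + B + 1) a b l).head?

theorem primrec_findConjugator {n k : ℕ} {s : Fin k → Perm (X n)}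
    (hs : Primrec₂ fun (c : Fin k × Bool) (p : X n) => letterPerm s c p)
    {N B : Word k × Word k → ℕ} (hN : Primrec N) (hB : Primrec B) :
    Primrec fun q : Word k × Word k => findConjugator s (N q) (B q) q.1 q.2 := by
  have hP := (primrec_pointsBelow n).comp hN
  exact Primrec.list_head?.comp ((primrecPred_conjugatesBelow hs).listFilter.comp
    (primrec_listsUpTo.comp (primrec_list_product.comp hP) (Primrec.list_length.comp hP))
    (Primrec.pair (Primrec.succ.comp (Primrec.nat_add.comp hN hB)) Primrec.id))

theorem exists_of_findConjugator_eq_some {n k : ℕ} {s : Fin k → Perm (X n)} {N B : ℕ}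
    {a b : Word k} {l : List (X n × X n)} (h : findConjugator s N B a b = some l) :
    (∀ q ∈ l, q.1.2 < N ∧ q.2.2 < N) ∧ ConjugatesBelow s (N + B + 1) a b l := by
  have hmem := List.mem_of_mem_head? (Option.mem_def.2 h)
  rw [List.mem_filter, mem_listsUpTo, decide_eq_true_iff] at hmem
  refine ⟨fun q hq => ?_, hmem.2⟩
  have := List.pair_mem_product.1 (hmem.1.2 q hq)
  rwa [mem_pointsBelow, mem_pointsBelow] at this

theorem isSome_findConjugator {n k : ℕ} {s : Fin k → Perm (X n)} {N : ℕ} (B : ℕ)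
    {a b : Word k} {x : Perm (X n)} (hx : ∀ i m, N ≤ m → x (i, m) = (i, m))
    (hxab : Conjugates x (wordPerm s a) (wordPerm s b)) :
    (findConjugator s N B a b).isSome := by
  obtain ⟨l, hl, hl', rfl⟩ := exists_swapsPerm_eq (pointsBelow n N).toFinset x (by
    rintro ⟨i, m⟩ hp
    rw [List.mem_toFinset, mem_pointsBelow, not_lt] at hp
    exact hx i m hp)
  simp only [List.mem_toFinset] at hl'
  rw [findConjugator, List.isSome_head?]
  refine List.ne_nil_of_mem (a := l) ?_
  rw [List.mem_filter, mem_listsUpTo, decide_eq_true_iff]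
  refine ⟨⟨hl.trans (List.toFinset_card_le _), fun q hq => ?_⟩, fun p _ => ?_⟩
  · exact List.pair_mem_product.2 (hl' q hq)
  · exact conjugates_iff.1 hxab p

/-- For eventual translations, being conjugated by a permutation supported below `N` is visible
below `N + B + 1`. -/
theorem conjugates_of_conjugatesBelow {n k : ℕ} {s : Fin k → Perm (X n)} {N B : ℕ} {a b : Word k}
    {l : List (X n × X n)} {σ τ : Perm (Fin n)} {t u : Fin n → ℤ}
    (ha : RayTranslates (wordPerm s a) σ t N B) (hb : RayTranslates (wordPerm s b) τ u N B)
    (hl : ∀ q ∈ l, q.1.2 < N ∧ q.2.2 < N) (h : ConjugatesBelow s (N + B + 1) a b l) :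
    Conjugates (swapsPerm l) (wordPerm s a) (wordPerm s b) := by
  have hfix : ∀ p : X n, N ≤ p.2 → swapsPerm l p = p := fun p hp =>
    swapsPerm_apply_of_forall_notMem fun q hq =>
      ⟨fun he => by have := (hl q hq).1; rw [← he] at this; omega,
        fun he => by have := (hl q hq).2; rw [← he] at this; omega⟩
  have hfix' : ∀ i m, N + B ≤ m →
      swapsPerm l (wordPerm s a (i, m)) = wordPerm s a (i, m) := by
    intro i m hm
    have h1 := ha.snd_apply i m (by omega)
    have h2 := ha.natAbs_le i
    exact hfix _ (by omega)
  refine conjugates_iff.2 fun p => ?_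
  obtain ⟨i, m⟩ := p
  rcases lt_or_ge m (N + B + 1) with hm | hm
  · exact h _ (mem_pointsBelow.2 hm)
  -- The `+ 1` puts level `N + B` among the tested ones. There the candidate fixes both the point
  -- and its `a`-image, so the test forces `a` and `b` to have the same data on ray `i`, which
  -- settles all higher points.
  · have h0 := h (i, N + B) (mem_pointsBelow.2 (Nat.lt_succ_self _))
    rw [hfix' i _ le_rfl, hfix _ (Nat.le_add_right N B)] at h0
    obtain ⟨h1, h2⟩ := ha.eq_of_apply_eq hb (Nat.le_add_right N B) (Nat.le_add_right N B) h0
    rw [hfix' i m (by omega), hfix (i, m) (by dsimp only; omega)]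
    exact ha.apply_eq_apply hb h1 h2 (by omega) (by omega)

end Houghton

/-! ### The algorithm. -/

theorem mainTheorem7 (n k : ℕ) (s : Fin k → Equiv.Perm (Houghton.X n))
    (hs : ∀ j, s j ∈ Houghton.HS n) :
    ∃ f : Houghton.Word k → Houghton.Word k → Option (List (Houghton.X n × Houghton.X n)),
      Computable₂ f ∧
      ∀ a b : Houghton.Word k,
        ((f a b).isSome ↔ ∃ x ∈ Houghton.FSym (Houghton.X n),
          Houghton.Conjugates x (Houghton.wordPerm s a) (Houghton.wordPerm s b)) ∧
        ∀ l, f a b = some l →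
          Houghton.swapsPerm l ∈ Houghton.FSym (Houghton.X n) ∧
          Houghton.Conjugates (Houghton.swapsPerm l)
            (Houghton.wordPerm s a) (Houghton.wordPerm s b) := by
  obtain ⟨C, σ, t, hletter⟩ := Houghton.exists_letterPerm_rayTranslates hs
  -- `B` bounds thresholds and shifts of both words; `N` is the support bound of
  -- `exists_conjugator_supported` with `Z = T = B`.
  let B : Houghton.Word k × Houghton.Word k → ℕ := fun q => 2 * C * (q.1.length + q.2.length)
  let N : Houghton.Word k × Houghton.Word k → ℕ := fun q =>
    B q + B q + Fintype.card (Equiv.Perm (Fin n)) * B q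
  have hB : Primrec B := Primrec.nat_mul.comp (Primrec.const _)
    (Primrec.nat_add.comp (Primrec.list_length.comp Primrec.fst)
      (Primrec.list_length.comp Primrec.snd))
  have hN : Primrec N := Primrec.nat_add.comp (Primrec.nat_add.comp hB hB)
    (Primrec.nat_mul.comp (Primrec.const _) hB)
  refine ⟨fun a b => Houghton.findConjugator s (N (a, b)) (B (a, b)) a b,
    (Houghton.primrec_findConjugator (Houghton.primrec_letterPerm hletter) hN hB).to_comp,
    fun a b => ?_⟩
  obtain ⟨σa, ta, ha⟩ := Houghton.exists_wordPerm_rayTranslates hletter a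
  obtain ⟨σb, tb, hb⟩ := Houghton.exists_wordPerm_rayTranslates hletter b
  have hBa : 2 * C * a.length ≤ B (a, b) := Nat.mul_le_mul_left _ (Nat.le_add_right _ _)
  have hBb : 2 * C * b.length ≤ B (a, b) := Nat.mul_le_mul_left _ (Nat.le_add_left _ _)
  have hBN : B (a, b) ≤ N (a, b) := (Nat.le_add_right _ _).trans (Nat.le_add_right _ _)
  have hsound : ∀ l, Houghton.findConjugator s (N (a, b)) (B (a, b)) a b = some l →
      Houghton.swapsPerm l ∈ Houghton.FSym (Houghton.X n) ∧
      Houghton.Conjugates (Houghton.swapsPerm l)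
        (Houghton.wordPerm s a) (Houghton.wordPerm s b) := by
    intro l hl
    obtain ⟨h1, h2⟩ := Houghton.exists_of_findConjugator_eq_some hl
    exact ⟨Houghton.swapsPerm_mem_FSym l, Houghton.conjugates_of_conjugatesBelow
      (ha.mono (hBa.trans hBN) hBa) (hb.mono (hBb.trans hBN) hBb) h1 h2⟩
  refine ⟨⟨fun h => ?_, ?_⟩, hsound⟩
  · obtain ⟨l, hl⟩ := Option.isSome_iff_exists.1 h
    exact ⟨_, hsound l hl⟩
  · rintro ⟨x, hx, hxab⟩
    obtain ⟨y, hy, hfix⟩ := Houghton.exists_conjugator_supported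
      (ha.mono hBa hBa) (hb.mono hBb hBb) hx hxab
    exact Houghton.isSome_findConjugator _ hfix hy
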